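/- **Setting.** For $n\ge 0$ let $\mathcal Y_n$ be the set of rooted planar binary trees with $n$ interior nodes; $|$ denotes the tree in $\mathcal Y_0$, and for $n\geq 1$ every tree in $\mathcal Y_n$ is uniquely $l\vee r$, the tree with left subtree $l$ and right subtree $r$ at the root. Order $\mathcal Y_n$ by the Tamari order, whose cover relations replace, somewhere in a tree, a subtree $(a\vee b)\vee c$ by $a\vee(b\vee c)$ (the latter being larger). Its minimum is the right comb $1_n$, given by $1_0=|$ and $1_{n+1}=1_n\vee|$. Order $\mathcal Y_p\times\mathcal Y_q$ componentwise. Let $\mathcal Y\mathrm{Sym}$ be the $\mathbb Q$-vector space with basis $\{F_t \mid t\in\bigsqcup_{n\ge0}\mathcal Y_n\}$ and the bilinear product defined as follows. Dividing a tree along the path from a leaf to the root splits it into a piece on the left and a piece on the right of that leaf (the leaf itself belongs to both pieces). For $t\in\mathcal Y_p$ and $s\in\mathcal Y_q$, $$F_t\cdot F_s=\sum_{t\to(t_0,\dots,t_q)}F_{(t_0,\dots,t_q)/s},$$ where the sum is over the $\binom{p+q}{q}$ ways to divide $t$ into $q+1$ pieces $t_0,\dots,t_q$ (from left to right) at a multisubset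 of $q$ of its $p+1$ leaves, and $(t_0,\dots,t_q)/s$ is obtained by attaching $t_i$ to the $i$-th leaf of $s$, the leaves being numbered $0,\dots,q$ from left to right. For $t\in\mathcal Y_n$ put $$M_t=\sum_{s\in\mathcal Y_n,\ t\le s}\mu_{\mathcal Y_n}(t,s)\,F_s ,$$ where $\mu_{\mathcal Y_n}$ is the Möbius function of $\mathcal Y_n$. The elements $M_t$, $t\in\bigsqcup_{n\geq 0}\mathcal Y_n$, form a basis of $\mathcal Y\mathrm{Sym}$, and coefficients below refer to this basis. Write permutations in one-line notation. Define $\lambda\colon\mathfrak S_n\to\mathcal Y_n$ recursively: $\lambda$ of the empty permutation is $|$, and for $n\ge1$ and $j=\sigma^{-1}(n)$, $\lambda(\sigma)=\lambda(\sigma_l)\vee\lambda(\sigma_r)$, where $\sigma_l$ and $\sigma_r$ are the standardizations of $(\sigma(1),\dots,\sigma(j-1))$ and $(\sigma(j+1),\dots,\sigma(n))$. For $\sigma\in\mathfrak S_p$ and $\tau\in\mathfrak S_q$, let $\sigma\vee\tau\in\mathfrak S_{p+q+1}$ be the permutation with values $\sigma(1)+q,\dots,\sigma(p)+q,\ p+q+1,\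 \tau(1),\dots,\tau(q)$, and let $\sigma/\tau\in\mathfrak S_{p+q}$ be the permutation with values $\sigma(1),\dots,\sigma(p),\ \tau(1)+p,\dots,\tau(q)+p$. Define $\gamma\colon\mathcal Y_n\to\mathfrak S_n$ by letting $\gamma(|)$ be the empty permutation and $\gamma(l\vee r)=\gamma(l)\vee\gamma(r)$. A $(p,q)$-shuffle is a permutation $\zeta\in\mathfrak S_{p+q}$ such that $\zeta(k)>\zeta(k+1)$ for no position $k$ other than possibly $k=p$ (so only the identity if $p=0$ or $q=0$); let $\mathfrak S^{(p,q)}$ be the set of these. For $\zeta\in\mathfrak S^{(p,q)}$ define $$f_\zeta\colon\mathcal Y_p\times\mathcal Y_q\to\mathcal Y_{p+q},\qquad f_\zeta(s,t)=\lambda\bigl((\gamma(s)/\gamma(t))\cdot\zeta^{-1}\bigr),$$ where $\cdot$ is composition of permutations. **Theorem.** Let $p,q\ge0$, $s\in\mathcal Y_p$ and $t\in\mathcal Y_q$. For every $r\in\mathcal Y_{p+q}$, the coefficient of $M_r$ in $M_s\cdot M_t$ is $$\#\bigl\{\zeta\in\mathfrak S^{(p,q)}\ \big|\ (s,t)=\max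 f_\zeta^{-1}[1_{p+q},r]\bigr\},$$ where $[1_{p+q},r]$ is the interval in $\mathcal Y_{p+q}$, and $(s,t)=\max f_\zeta^{-1}[1_{p+q},r]$ means that $(s,t)$ lies in $f_\zeta^{-1}[1_{p+q},r]$ and is greater than or equal to each of its elements. In particular, for every $n\ge0$ and $r\in\mathcal Y_n$, the coefficient of $M_r$ in $M_s\cdot M_t$ is non-negative. -/

import Mathlib

/-! The algebra of planar binary trees, its fundamental and monomial bases, and the maps
between planar binary trees and permutations.

Rooted planar binary trees are Mathlib's `BinaryTree Unit`: `nil` is the tree with one leaf and no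
interior node, `node () l r` is the tree obtained by grafting `l` and `r` onto the left and
right leaf of the tree with one interior node, and `numNodes` counts the interior nodes.
Permutations of `{1, …, n}` are `Equiv.Perm (Fin n)`; positions and values are shifted by one. -/

open BinaryTree

namespace YSymmetric

/-! ### Planar binary trees with `n` interior nodes and the Tamari order -/

/-- The set of rooted planar binary trees with `n` interior nodes. -/
@[ext] structure Y (n : ℕ) where
  /-- the underlying planar binary tree -/
  tree : BinaryTree Unit
  numNodes_eq : tree.numNodes = n

instance (n : ℕ) : DecidableEq (Y n) := fun s t =>
  decidable_of_iff (s.tree = t.tree) Y.ext_iff.symm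

instance (n : ℕ) : Fintype (Y n) :=
  Fintype.ofEquiv (treesOfNumNodesEq n)
    { toFun := fun t => ⟨t.1, mem_treesOfNumNodesEq.mp t.2⟩
      invFun := fun t => ⟨t.tree, mem_treesOfNumNodesEq.mpr t.numNodes_eq⟩
      left_inv := fun _ => rfl
      right_inv := fun _ => rfl }

/-- `Rotation s t`: the tree `t` arises from `s` by moving one child node directly above some node
from the left branch to the right branch above that node. -/
inductive Rotation : BinaryTree Unit → BinaryTree Unit → Prop
  | root (a b c : BinaryTree Unit) :
      Rotation (node () (node () a b) c) (node () a (node () b c))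
  | left {l l' : BinaryTree Unit} (r : BinaryTree Unit) (h : Rotation l l') :
      Rotation (node () l r) (node () l' r)
  | right (l : BinaryTree Unit) {r r' : BinaryTree Unit} (h : Rotation r r') :
      Rotation (node () l r) (node () l r')

/-- The sum over all nodes of the size of the right subtree (used for antisymmetry only). -/
def rightWeight : BinaryTree Unit → ℕ
  | nil => 0
  | node _ l r => rightWeight l + rightWeight r + r.numNodes

theorem Rotation.numNodes_eq {s t : BinaryTree Unit} (h : Rotation s t) :
    s.numNodes = t.numNodes := by
  induction h with
  | root a b c => simp only [numNodes]; omega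
  | left r h ih => simp only [numNodes]; omega
  | right l h ih => simp only [numNodes]; omega

theorem Rotation.rightWeight_lt {s t : BinaryTree Unit} (h : Rotation s t) :
    rightWeight s < rightWeight t := by
  induction h with
  | root a b c => simp only [rightWeight, numNodes]; omega
  | left r h ih => simp only [rightWeight]; omega
  | right l h ih => have := h.numNodes_eq; simp only [rightWeight]; omega

theorem eq_or_rightWeight_lt {s t : BinaryTree Unit} (h : Relation.ReflTransGen Rotation s t) :
    s = t ∨ rightWeight s < rightWeight t := by
  induction h with
  | refl => exact Or.inl rfl
  | tail _ hr ih =>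
    have := hr.rightWeight_lt
    rcases ih with rfl | h
    · exact Or.inr this
    · exact Or.inr (h.trans this)

/-- The Tamari order: the reflexive and transitive closure of `Rotation`. -/
instance (n : ℕ) : PartialOrder (Y n) where
  le s t := Relation.ReflTransGen Rotation s.tree t.tree
  le_refl _ := Relation.ReflTransGen.refl
  le_trans _ _ _ h₁ h₂ := h₁.trans h₂
  le_antisymm s t h₁ h₂ := by
    apply Y.ext
    rcases eq_or_rightWeight_lt h₁ with h | h
    · exact h
    · rcases eq_or_rightWeight_lt h₂ with h' | h'
      · exact h'.symm
      · omega

noncomputable instance (n : ℕ) : DecidableLE (Y n) := Classical.decRel _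

noncomputable instance (n : ℕ) : DecidableLT (Y n) := Classical.decRel _

noncomputable instance (n : ℕ) : LocallyFiniteOrder (Y n) := Fintype.toLocallyFiniteOrder

/-- The tree underlying the right comb `1ₙ`: all interior nodes lie on the leftmost branch, so all
leaves (but the leftmost one) point to the right. -/
def combTree : ℕ → BinaryTree Unit
  | 0 => nil
  | n + 1 => node () (combTree n) nil

theorem numNodes_combTree (n : ℕ) : (combTree n).numNodes = n := by
  induction n with
  | zero => rfl
  | succ n ih => simp [combTree, ih]

/-- The right comb `1ₙ`, which is the minimum of the Tamari order on `Y n`. -/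
def comb (n : ℕ) : Y n := ⟨combTree n, numNodes_combTree n⟩

theorem comb_le {n : ℕ} (t : Y n) : comb n ≤ t := by
  have key : ∀ r l : BinaryTree Unit, Relation.ReflTransGen Rotation (combTree l.numNodes) l →
      Relation.ReflTransGen Rotation (combTree (node () l r).numNodes) (node () l r) := by
    intro r
    induction r with
    | nil =>
      intro l hl
      exact hl.lift (fun x => node () x nil) fun _ _ h => Rotation.left nil h
    | node _ r₁ r₂ ih₁ ih₂ =>
      intro l hl
      have h := (ih₂ _ (ih₁ l hl)).tail (Rotation.root l r₁ r₂)
      have e : (node () (node () l r₁) r₂).numNodes = (node () l (node () r₁ r₂)).numNodes := by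
        simp only [numNodes]
        omega
      rwa [e] at h
  have all : ∀ t : BinaryTree Unit, Relation.ReflTransGen Rotation (combTree t.numNodes) t := by
    intro t
    induction t with
    | nil => exact Relation.ReflTransGen.refl
    | node _ l r ihl _ => exact key r l ihl
  obtain ⟨t, rfl⟩ := t
  exact all t

/-! ### Permutations and trees -/

/-- The decreasing tree of a word `w`, recursively: split `w` at its maximal letter and
graft the trees of the part to the left and of the part to the right of that letter. The tree
depends only on the relative order of the letters (see `decTree_standardize`), so the two parts
need not be standardized first. -/
def decTree (w : List ℕ) : BinaryTree Unit :=
  if h : w = [] then nil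
  else
    node () (decTree (w.take (w.idxOf (w.max h)))) (decTree (w.drop (w.idxOf (w.max h) + 1)))
termination_by w.length
decreasing_by
  · have := List.idxOf_lt_length_of_mem (List.max_mem h)
    simp only [List.length_take]
    omega
  · have := List.length_pos_iff.mpr h
    simp only [List.length_drop]
    omega

theorem numNodes_decTree (w : List ℕ) : (decTree w).numNodes = w.length := by
  induction w using decTree.induct with
  | case1 => simp [decTree]
  | case2 w h ih₁ ih₂ =>
    have := List.idxOf_lt_length_of_mem (List.max_mem h)
    rw [decTree, dif_neg h, numNodes, ih₁, ih₂, List.length_take, List.length_drop]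
    omega

/-- Standardization of a word (with values starting at `0`). -/
def standardize (w : List ℕ) : List ℕ := w.map fun a => w.countP (· < a)

theorem decTree_map (f : ℕ → ℕ) (w : List ℕ)
    (hf : ∀ a ∈ w, ∀ b ∈ w, a < b → f a < f b) : decTree (w.map f) = decTree w := by
  induction w using decTree.induct with
  | case1 => rfl
  | case2 w h ih₁ ih₂ =>
    have h' : w.map f ≠ [] := by simpa using h
    have hmono : ∀ a ∈ w, ∀ b ∈ w, a ≤ b → f a ≤ f b := by
      intro a ha b hb hab
      rcases hab.eq_or_lt with rfl | hlt
      · exact le_rfl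
      · exact (hf a ha b hb hlt).le
    have hmax : (w.map f).max h' = f (w.max h) := by
      apply le_antisymm
      · obtain ⟨a, ha, hfa⟩ := List.mem_map.mp (List.max_mem h')
        rw [← hfa]
        exact hmono a ha _ (List.max_mem h) (List.le_max_of_mem ha)
      · exact List.le_max_of_mem (List.mem_map_of_mem (List.max_mem h))
    have hidx : ∀ (v : List ℕ) (m : ℕ), (∀ a ∈ v, f a = f m → a = m) →
        (v.map f).idxOf (f m) = v.idxOf m := by
      intro v m
      induction v with
      | nil => simp
      | cons x v ihv =>
        intro hx
        rw [List.map_cons, List.idxOf_cons, List.idxOf_cons,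
          ihv fun a ha => hx a (List.mem_cons_of_mem _ ha)]
        by_cases hxm : x = m
        · simp [hxm]
        · have : f x ≠ f m := fun he => hxm (hx x List.mem_cons_self he)
          simp [beq_eq_false_iff_ne.mpr hxm, beq_eq_false_iff_ne.mpr this]
    have hi : (w.map f).idxOf ((w.map f).max h') = w.idxOf (w.max h) := by
      rw [hmax]
      apply hidx
      intro a ha hfa
      rcases (List.le_max_of_mem ha).eq_or_lt with he | hlt
      · exact he
      · exact absurd hfa (hf a ha _ (List.max_mem h) hlt).ne
    rw [decTree.eq_def (w.map f), dif_neg h', decTree.eq_def w, dif_neg h, hi, ← List.map_take,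
      ← List.map_drop, ih₁ fun a ha b hb => hf a (List.mem_of_mem_take ha) b (List.mem_of_mem_take hb),
      ih₂ fun a ha b hb => hf a (List.mem_of_mem_drop ha) b (List.mem_of_mem_drop hb)]

theorem decTree_standardize (w : List ℕ) : decTree (standardize w) = decTree w := by
  apply decTree_map
  intro a ha b _ hab
  have hsub : ∀ v : List ℕ, v.countP (· < a) ≤ v.countP (· < b) := by
    intro v
    apply List.countP_mono_left
    intro x _ hx
    simp only [decide_eq_true_eq] at hx ⊢
    omega
  obtain ⟨u, v, rfl⟩ := List.append_of_mem ha
  have h₁ := hsub u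
  have h₂ := hsub v
  simp only [List.countP_append, List.countP_cons, lt_irrefl, hab, decide_true, decide_false,
    if_true]
  simp only [Bool.false_eq_true, if_false]
  omega

/-- The map `λ : 𝔖ₙ → Yₙ`, sending a permutation to the decreasing tree of its one-line
notation. -/
def lam {n : ℕ} (σ : Equiv.Perm (Fin n)) : Y n :=
  ⟨decTree (List.ofFn fun i => (σ i : ℕ)), by rw [numNodes_decTree, List.length_ofFn]⟩

/-- The permutation `σ / τ` with values `σ(1), …, σ(p), τ(1) + p, …, τ(q) + p`. -/
def slash {p q : ℕ} (σ : Equiv.Perm (Fin p)) (τ : Equiv.Perm (Fin q)) :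
    Equiv.Perm (Fin (p + q)) :=
  finSumFinEquiv.permCongr (Equiv.sumCongr σ τ)

/-- Positions `1, …, p`, then `p + 1`, then `p + 2, …, p + q + 1`. -/
def graftPos (p q : ℕ) : (Fin p ⊕ Fin 1) ⊕ Fin q ≃ Fin (p + q + 1) :=
  ((finSumFinEquiv.sumCongr (Equiv.refl (Fin q))).trans finSumFinEquiv).trans
    (finCongr (by omega))

/-- Values `q + 1, …, q + p`, then `p + q + 1`, then `1, …, q`. -/
def graftVal (p q : ℕ) : (Fin p ⊕ Fin 1) ⊕ Fin q ≃ Fin (p + q + 1) :=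
  ((Equiv.sumComm (Fin p ⊕ Fin 1) (Fin q)).trans
    (((Equiv.refl (Fin q)).sumCongr finSumFinEquiv).trans finSumFinEquiv)).trans
    (finCongr (by omega))

/-- The grafting `σ ∨ τ` of permutations, with values
`σ(1) + q, …, σ(p) + q, p + q + 1, τ(1), …, τ(q)`. -/
def graft {p q : ℕ} (σ : Equiv.Perm (Fin p)) (τ : Equiv.Perm (Fin q)) :
    Equiv.Perm (Fin (p + q + 1)) :=
  ((graftPos p q).symm.trans
    (Equiv.sumCongr (Equiv.sumCongr σ (Equiv.refl (Fin 1))) τ)).trans (graftVal p q)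

/-- The recursion `γ(|) = id₀`, `γ(l ∨ r) = γ(l) ∨ γ(r)`. -/
def gammaTree : (t : BinaryTree Unit) → Equiv.Perm (Fin t.numNodes)
  | nil => Equiv.refl (Fin 0)
  | node _ l r => graft (gammaTree l) (gammaTree r)

/-- The map `γ : Yₙ → 𝔖ₙ`. -/
def gamma {n : ℕ} (t : Y n) : Equiv.Perm (Fin n) := (finCongr t.numNodes_eq).permCongr (gammaTree t.tree)

/-- The set of descents of a permutation: the positions `k` (counted from `1`) with
`σ(k) > σ(k + 1)`. -/
def descents {n : ℕ} (σ : Equiv.Perm (Fin n)) : Set ℕ :=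
  {k | ∃ i j : Fin n, (i : ℕ) + 1 = k ∧ (j : ℕ) = k ∧ σ j < σ i}

/-- The `(p, q)`-shuffles: the permutations with at most one descent, at position `p`.
If `p = 0` or `q = 0`, this is only the identity. -/
def shuffles (p q : ℕ) : Set (Equiv.Perm (Fin (p + q))) := {ζ | descents ζ ⊆ {p}}

/-- The map `f_ζ : Y_p × Y_q → Y_{p+q}`, `f_ζ(s, t) = λ((γ(s) / γ(t)) · ζ⁻¹)`. -/
def fMap {p q : ℕ} (ζ : Equiv.Perm (Fin (p + q))) (x : Y p × Y q) : Y (p + q) :=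
  lam (slash (gamma x.1) (gamma x.2) * ζ⁻¹)

/-! ### The algebra of planar binary trees -/

/-- The rational vector space with basis the set of all planar binary trees. -/
def YSym : Type := BinaryTree Unit →₀ ℚ

noncomputable instance : AddCommGroup YSym := inferInstanceAs (AddCommGroup (BinaryTree Unit →₀ ℚ))

noncomputable instance : Module ℚ YSym := inferInstanceAs (Module ℚ (BinaryTree Unit →₀ ℚ))

/-- The fundamental basis `F_t`. -/
noncomputable def fundamentalBasis : Module.Basis (BinaryTree Unit) ℚ YSym :=
  Module.Basis.ofRepr (LinearEquiv.refl ℚ (BinaryTree Unit →₀ ℚ))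

/-- The element `F_t` of the fundamental basis. -/
noncomputable def fundamental (t : BinaryTree Unit) : YSym := fundamentalBasis t

/-- The divisions `t → (t₀, t₁)` of a tree along the path from a leaf to the root, one for each
leaf, listed from the leftmost to the rightmost leaf. -/
def splits : BinaryTree Unit → List (BinaryTree Unit × BinaryTree Unit)
  | nil => [(nil, nil)]
  | node _ l r =>
      (splits l).map (fun x => (x.1, node () x.2 r)) ++
        (splits r).map (fun x => (node () l x.1, x.2))

/-- The divisions `t → (t₀, …, t_q)` of a tree into `q + 1` pieces at a multisubset of `q` of its
leaves, one for each multisubset: first cut at the leftmost leaf of the multisubset, then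
divide the piece on the right, whose leaves are those of `t` from that leaf on. -/
def divisions : ℕ → BinaryTree Unit → List (List (BinaryTree Unit))
  | 0, t => [[t]]
  | q + 1, t => (splits t).flatMap fun x => (divisions q x.2).map (x.1 :: ·)

/-- The tree `(t₀, …, t_q) / s` obtained by attaching `tᵢ` to the `i`-th leaf of `s`,
where `s` has `q + 1` leaves. -/
def attach : BinaryTree Unit → List (BinaryTree Unit) → BinaryTree Unit
  | nil, ts => ts.headD nil
  | node _ l r, ts => node () (attach l (ts.take l.numLeaves)) (attach r (ts.drop l.numLeaves))

/-- The product of two elements of the fundamental basis: the sum of `F_{(t₀, …, t_q)/s}` over all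
divisions `t → (t₀, …, t_q)`, where `q` is the number of interior nodes of `s`. -/
noncomputable def fundamentalMul (t s : BinaryTree Unit) : YSym :=
  ((divisions s.numNodes t).map fun ts => fundamental (attach s ts)).sum

/-- The product is the bilinear extension of `fundamentalMul`. -/
noncomputable def mulBilin : YSym →ₗ[ℚ] YSym →ₗ[ℚ] YSym :=
  fundamentalBasis.constr ℚ fun t => fundamentalBasis.constr ℚ fun s => fundamentalMul t s

noncomputable instance : Mul YSym := ⟨fun x y => mulBilin x y⟩

theorem fundamental_mul_fundamental (t s : BinaryTree Unit) :
    fundamental t * fundamental s = fundamentalMul t s := by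
  change mulBilin (fundamentalBasis t) (fundamentalBasis s) = _
  simp [mulBilin, Module.Basis.constr_basis]

/-- The element `M_t` of the monomial basis: the sum of `μ(t, s) F_s` over all `s ≥ t` in
the Tamari order, where `μ` is the Möbius function of `Y n`. -/
noncomputable def monomial {n : ℕ} (t : Y n) : YSym :=
  ∑ s : Y n with t ≤ s, IncidenceAlgebra.mu ℚ t s • fundamental s.tree

/-- The linear map `F_t ↦ M_t`. -/
noncomputable def toMonomial : YSym →ₗ[ℚ] YSym :=
  fundamentalBasis.constr ℚ fun t => monomial ⟨t, rfl⟩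

/-- The linear map sending `F_t` to the sum of all `F_s` with `s ≥ t`. -/
noncomputable def upperSum : YSym →ₗ[ℚ] YSym :=
  fundamentalBasis.constr ℚ fun t => ∑ s : Y t.numNodes with ⟨t, rfl⟩ ≤ s, fundamental s.tree

theorem toMonomial_fundamental {n : ℕ} (t : Y n) :
    toMonomial (fundamental t.tree) = monomial t := by
  obtain ⟨t, rfl⟩ := t
  simp [toMonomial, fundamental, Module.Basis.constr_basis]

theorem upperSum_fundamental {n : ℕ} (t : Y n) :
    upperSum (fundamental t.tree) = ∑ s : Y n with t ≤ s, fundamental s.tree := by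
  obtain ⟨t, rfl⟩ := t
  simp [upperSum, fundamental, Module.Basis.constr_basis]

theorem sum_interval {n : ℕ} (g : Y n → Y n → ℚ) (t : Y n)
    (hg : ∀ u, ∑ s ∈ Finset.Icc t u, g s u = if t = u then 1 else 0) :
    ∑ s : Y n with t ≤ s, ∑ u : Y n with s ≤ u, g s u • fundamental u.tree = fundamental t.tree := by
  have h : ∀ u : Y n, ∑ s : Y n, (if t ≤ s then if s ≤ u then g s u • fundamental u.tree else 0 else 0)
      = if t = u then fundamental u.tree else 0 := by
    intro u
    have := congrArg (· • fundamental u.tree) (hg u)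
    simp only [Finset.sum_smul, ite_smul, one_smul, zero_smul] at this
    rw [← this, ← Finset.sum_filter, ← Finset.sum_filter, Finset.filter_filter]
    refine Finset.sum_congr ?_ fun _ _ => rfl
    ext s
    simp
  simp only [Finset.sum_filter]
  calc _ = ∑ s : Y n, ∑ u : Y n,
        (if t ≤ s then if s ≤ u then g s u • fundamental u.tree else 0 else 0) := by
          refine Finset.sum_congr rfl fun s _ => ?_
          split_ifs <;> simp
    _ = _ := by
          rw [Finset.sum_comm]
          simp [h]

theorem toMonomial_comp_upperSum : toMonomial ∘ₗ upperSum = LinearMap.id := by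
  refine fundamentalBasis.ext fun t => ?_
  change toMonomial (upperSum (fundamental t)) = fundamental t
  have h := upperSum_fundamental (⟨t, rfl⟩ : Y t.numNodes)
  dsimp only at h
  rw [h, map_sum]
  simp only [toMonomial_fundamental, monomial]
  exact sum_interval (fun s u => IncidenceAlgebra.mu ℚ s u) ⟨t, rfl⟩
    fun u => IncidenceAlgebra.sum_Icc_mu_left _ _

theorem upperSum_comp_toMonomial : upperSum ∘ₗ toMonomial = LinearMap.id := by
  refine fundamentalBasis.ext fun t => ?_
  change upperSum (toMonomial (fundamental t)) = fundamental t
  have h := toMonomial_fundamental (⟨t, rfl⟩ : Y t.numNodes)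
  dsimp only at h
  rw [h]
  simp only [monomial, map_sum, map_smul, upperSum_fundamental, Finset.smul_sum]
  exact sum_interval (fun s _ => IncidenceAlgebra.mu ℚ (⟨t, rfl⟩ : Y t.numNodes) s) ⟨t, rfl⟩
    fun u => IncidenceAlgebra.sum_Icc_mu_right _ _

/-- The monomial basis `M_t`, indexed by all planar binary trees. -/
noncomputable def monomialBasis : Module.Basis (BinaryTree Unit) ℚ YSym :=
  fundamentalBasis.map
    (LinearEquiv.ofLinearMap toMonomial upperSum toMonomial_comp_upperSum upperSum_comp_toMonomial)

theorem monomialBasis_apply {n : ℕ} (t : Y n) : monomialBasis t.tree = monomial t := by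
  rw [← toMonomial_fundamental]
  simp [monomialBasis, fundamental]

end YSymmetric

/-! The `F`-basis is summed up from the `M`-basis, `F_s = ∑_{u ≥ s} M_u`, so by Möbius inversion on
`Y p × Y q` it suffices to compare, for all `x = (s, t)`, the sums over all `y ≥ x` of the two sides
of the claimed identity.

On the left, this gives the coefficient of `M_r` in `F_s · F_t`. A decreasing tree is divided and
grafted by cutting and interleaving its word (`splits_decTree`, `attach_decTree`), so
`F_s · F_t` is the sum of the `F_{f_ζ(s, t)}` over all shuffles `ζ` (`fundamental_mul_eq_sum`), and
the coefficient is the number of shuffles with `f_ζ(s, t) ≤ r`.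

On the right, each shuffle with `f_ζ(x) ≤ r` has to be counted exactly once, that is,
`f_ζ⁻¹ [1, r]` has to be empty or a principal lower set (`fMap_le_iff`). Number the nodes
of a tree in inorder and write `Below t i j` if node `i` lies in the left subtree of node `j > i`.
The Tamari order is reverse inclusion of these relations (`le_iff_below`), the pairs in `Below t`
are the noninversions of `γ(t)` (`gamma_lt_iff`), and `λ(σ) ≤ r` holds if and only if no pair
in `Below r` is an inversion of `σ` (`lam_le_iff`). For `σ = (γ(s) / γ(t)) · ζ⁻¹` the pairs with
both positions in the image under `ζ` of the same block give an upper bound for `s` and one for `t`,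
while the pairs with positions from different blocks give a condition on `ζ` and `r` only. -/

open BinaryTree

namespace YSymmetric

/-! ### Left subtrees and the Tamari order -/

/-- The number of nodes in the left subtree of the `j`-th node of a tree, the nodes being numbered
from `0` in inorder (the value is `0` if there is no such node). -/
def leftSize : BinaryTree Unit → ℕ → ℕ
  | nil, _ => 0
  | node _ l r, j =>
      if j < l.numNodes then leftSize l j
      else if j = l.numNodes then l.numNodes
      else leftSize r (j - l.numNodes - 1)

theorem leftSize_node_of_lt {l r : BinaryTree Unit} {j : ℕ} (h : j < l.numNodes) :
    leftSize (node () l r) j = leftSize l j := by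
  rw [leftSize, if_pos h]

theorem leftSize_node_root (l r : BinaryTree Unit) :
    leftSize (node () l r) l.numNodes = l.numNodes := by
  simp [leftSize]

theorem leftSize_node_add (l r : BinaryTree Unit) (j : ℕ) :
    leftSize (node () l r) (l.numNodes + 1 + j) = leftSize r j := by
  rw [leftSize, if_neg (by omega), if_neg (by omega)]
  congr 1
  omega

theorem leftSize_le (t : BinaryTree Unit) (j : ℕ) : leftSize t j ≤ j := by
  induction t generalizing j with
  | nil => exact Nat.zero_le _
  | node _ l r ihl ihr =>
    rw [leftSize]
    have := ihl j
    have := ihr (j - l.numNodes - 1)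
    split_ifs <;> omega

theorem Rotation.leftSize_le {s t : BinaryTree Unit} (h : Rotation s t) (j : ℕ) :
    leftSize t j ≤ leftSize s j := by
  induction h generalizing j with
  | root a b c =>
    simp only [leftSize, numNodes]
    have e : j - a.numNodes - 1 - b.numNodes - 1 = j - (a.numNodes + b.numNodes + 1) - 1 := by omega
    rw [e]
    grind
  | left r h ih =>
    have := h.numNodes_eq
    have := ih j
    simp only [leftSize, h.numNodes_eq]
    split_ifs <;> omega
  | right l h ih =>
    have := ih (j - l.numNodes - 1)
    simp only [leftSize]
    split_ifs <;> omega

theorem numNodes_eq_of_reflTransGen {s t : BinaryTree Unit}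
    (h : Relation.ReflTransGen Rotation s t) : s.numNodes = t.numNodes := by
  induction h with
  | refl => rfl
  | tail _ hr ih => exact ih.trans hr.numNodes_eq

theorem leftSize_le_of_reflTransGen {s t : BinaryTree Unit}
    (h : Relation.ReflTransGen Rotation s t) (j : ℕ) : leftSize t j ≤ leftSize s j := by
  induction h with
  | refl => exact le_rfl
  | tail _ hr ih => exact (hr.leftSize_le j).trans ih

theorem reflTransGen_node {l l' r r' : BinaryTree Unit}
    (hl : Relation.ReflTransGen Rotation l l') (hr : Relation.ReflTransGen Rotation r r') :
    Relation.ReflTransGen Rotation (node () l r) (node () l' r') :=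
  (hl.lift (fun x => node () x r) fun _ _ h => Rotation.left r h).trans
    (hr.lift (fun x => node () l' x) fun _ _ h => Rotation.right l' h)

/-- A node on the leftmost branch can be rotated up to the root. This costs the nodes after it
no more of their left subtrees than the part that reaches down to the new root. -/
theorem exists_reflTransGen_node (s : BinaryTree Unit) (k : ℕ) (hk : k < s.numNodes)
    (h : leftSize s k = k) :
    ∃ l r : BinaryTree Unit, l.numNodes = k ∧
      Relation.ReflTransGen Rotation s (node () l r) ∧
      (∀ j < k, leftSize l j = leftSize s j) ∧
      ∀ j, k < j → min (leftSize s j) (j - k - 1) ≤ leftSize r (j - k - 1) := by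
  induction s with
  | nil => simp [numNodes] at hk
  | node _ a b iha _ =>
    rcases lt_trichotomy k a.numNodes with hlt | rfl | hgt
    · rw [leftSize_node_of_lt hlt] at h
      obtain ⟨l, r, hl, hrot, h₁, h₂⟩ := iha hlt h
      have hn := numNodes_eq_of_reflTransGen hrot
      simp only [numNodes] at hn
      refine ⟨l, node () r b, hl,
        (reflTransGen_node hrot .refl).tail (Rotation.root l r b), ?_, ?_⟩
      · intro j hj
        rw [h₁ j hj, leftSize_node_of_lt (by omega)]
      · intro j hj
        have := h₂ j hj
        have e : j - k - 1 - r.numNodes - 1 = j - a.numNodes - 1 := by omega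
        simp only [leftSize, e]
        split_ifs <;> omega
    · refine ⟨a, b, rfl, .refl, fun j hj => (leftSize_node_of_lt hj).symm, fun j hj => ?_⟩
      rw [leftSize, if_neg (by omega), if_neg (by omega)]
      exact min_le_left _ _
    · rw [leftSize, if_neg (by omega), if_neg (by omega)] at h
      have := leftSize_le b (k - a.numNodes - 1)
      omega

/-- Trees with smaller left subtrees are larger in the Tamari order: if the root of `t` has `k` nodes
on its left, then the `k`-th node of `s` lies on the leftmost branch, hence can be rotated up to
the root, and this keeps all left subtrees at least as large as those of `t`. -/
theorem reflTransGen_of_leftSize_le (t s : BinaryTree Unit) (hn : s.numNodes = t.numNodes)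
    (h : ∀ j < t.numNodes, leftSize t j ≤ leftSize s j) : Relation.ReflTransGen Rotation s t := by
  induction t generalizing s with
  | nil =>
    cases s with
    | nil => exact .refl
    | node => simp [numNodes] at hn
  | node _ c d ihc ihd =>
    have hroot := h c.numNodes (by simp only [numNodes]; omega)
    rw [leftSize_node_root] at hroot
    obtain ⟨l, r, hl, hrot, h₁, h₂⟩ := exists_reflTransGen_node s c.numNodes
      (by simp only [hn, numNodes]; omega) (le_antisymm (leftSize_le _ _) hroot)
    have hn' := numNodes_eq_of_reflTransGen hrot
    simp only [numNodes] at hn hn' h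
    refine hrot.trans (reflTransGen_node (ihc l hl fun j hj => ?_)
      (ihd r (by omega) fun j hj => ?_))
    · have := h j (by omega)
      rwa [h₁ j hj, ← leftSize_node_of_lt hj]
    · have h₃ := h (c.numNodes + 1 + j) (by omega)
      have h₄ := h₂ (c.numNodes + 1 + j) (by omega)
      have h₅ := leftSize_le d j
      have e : c.numNodes + 1 + j - c.numNodes - 1 = j := by omega
      rw [leftSize_node_add] at h₃
      rw [e] at h₄
      omega

/-- For `i < j`: the `i`-th node of `t` (in inorder) lies in the left subtree of the `j`-th. -/
def Below (t : BinaryTree Unit) (i j : ℕ) : Prop := j ≤ i + leftSize t j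

theorem Below.mono {t : BinaryTree Unit} {i i' j : ℕ} (h : Below t i j) (hi : i ≤ i') :
    Below t i' j :=
  h.trans (Nat.add_le_add_right hi _)

/-- The Tamari order is reverse inclusion of the relations `Below`. -/
theorem le_iff_below {n : ℕ} {s t : Y n} :
    s ≤ t ↔ ∀ i j, i < j → j < n → Below t.tree i j → Below s.tree i j := by
  constructor
  · intro h i j _ _ hb
    exact hb.trans (Nat.add_le_add_left (leftSize_le_of_reflTransGen h j) i)
  · intro h
    refine reflTransGen_of_leftSize_le _ _ (s.numNodes_eq.trans t.numNodes_eq.symm) fun j hj => ?_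
    rw [t.numNodes_eq] at hj
    have hle := leftSize_le t.tree j
    rcases Nat.eq_zero_or_pos (leftSize t.tree j) with h0 | hpos
    · omega
    · have := h (j - leftSize t.tree j) j (by omega) hj (by unfold Below; omega)
      unfold Below at this
      omega

/-! ### Trees of words and of permutations -/

theorem decTree_nil : decTree [] = nil := by simp [decTree]

theorem decTree_append_cons {u v : List ℕ} {m : ℕ} (hu : ∀ x ∈ u, x < m) (hv : ∀ x ∈ v, x ≤ m) :
    decTree (u ++ m :: v) = node () (decTree u) (decTree v) := by
  have h : u ++ m :: v ≠ [] := by simp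
  have hmax : (u ++ m :: v).max h = m := by
    apply le_antisymm
    · have := List.max_mem h
      rw [List.mem_append, List.mem_cons] at this
      rcases this with h | h | h
      · exact (hu _ h).le
      · exact h.le
      · exact hv _ h
    · exact List.le_max_of_mem (by simp)
  have hidx : (u ++ m :: v).idxOf m = u.length := by
    rw [List.idxOf_append_of_notMem fun hm => (hu m hm).false]
    simp
  rw [decTree, dif_neg h, hmax, hidx]
  simp

/-- Induction along the recursion of `decTree`: a nonempty word is split at its first maximal
letter. -/
theorem decTree_induction {P : List ℕ → Prop} (nil : P [])
    (split : ∀ u m v, (∀ x ∈ u, x < m) → (∀ x ∈ v, x ≤ m) → P u → P v → P (u ++ m :: v))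
    (w : List ℕ) : P w := by
  induction w using decTree.induct with
  | case1 => exact nil
  | case2 w h ih₁ ih₂ =>
    have hmem := List.max_mem h
    have hlt := List.idxOf_lt_length_of_mem hmem
    have e : w = w.take (w.idxOf (w.max h)) ++ w.max h :: w.drop (w.idxOf (w.max h) + 1) := by
      conv_lhs => rw [← List.take_append_drop (w.idxOf (w.max h)) w]
      rw [List.drop_eq_getElem_cons hlt, List.getElem_idxOf hlt]
    rw [e]
    refine split _ _ _ (fun x hx => ?_) (fun x hx => ?_) ih₁ ih₂
    · refine lt_of_le_of_ne (List.le_max_of_mem (List.mem_of_mem_take hx)) ?_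
      rintro rfl
      obtain ⟨i, hi, hxi⟩ := List.mem_iff_getElem.mp hx
      rw [List.getElem_take] at hxi
      simp only [List.length_take] at hi
      have := List.not_of_lt_findIdx (p := (· == w.max h)) (lt_of_lt_of_le hi (min_le_left _ _))
      simp [hxi] at this
    · exact List.le_max_of_mem (List.mem_of_mem_drop hx)

/-- In the decreasing tree of a word, the `i`-th node lies in the left subtree of the `j`-th one if
all the letters from the `i`-th one on are smaller than the `j`-th one. -/
theorem below_decTree (w : List ℕ) {i j : ℕ} (hij : i < j) (hj : j < w.length) :
    Below (decTree w) i j ↔ ∀ k, i ≤ k → k < j → w.getD k 0 < w.getD j 0 := by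
  induction w using decTree_induction generalizing i j with
  | nil => simp at hj
  | split u m v hu hv ihu ihv =>
    have hlen := numNodes_decTree u
    rw [decTree_append_cons hu hv]
    have hgu : ∀ k < u.length, (u ++ m :: v).getD k 0 = u.getD k 0 := fun k hk =>
      List.getD_append _ _ _ _ hk
    have hgm : (u ++ m :: v).getD u.length 0 = m := by
      rw [List.getD_append_right _ _ _ _ le_rfl]
      simp
    have hgv : ∀ k, (u ++ m :: v).getD (u.length + 1 + k) 0 = v.getD k 0 := fun k => by
      rw [List.getD_append_right _ _ _ _ (by omega),
        show u.length + 1 + k - u.length = k + 1 by omega]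
      simp
    have hmem : ∀ (x : List ℕ) k, k < x.length → x.getD k 0 ∈ x := fun x k hk => by
      rw [List.getD_eq_getElem _ _ hk]
      exact List.getElem_mem hk
    rcases lt_trichotomy j u.length with hlt | rfl | hgt
    · unfold Below at ihu ⊢
      rw [leftSize_node_of_lt (by omega), ihu hij hlt]
      refine forall_congr' fun k => forall_congr' fun _ => forall_congr' fun hk => ?_
      rw [hgu k (by omega), hgu j hlt]
    · have : Below (node () (decTree u) (decTree v)) i u.length := by
        unfold Below
        have := leftSize_node_root (decTree u) (decTree v)
        rw [hlen] at this
        omega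
      refine iff_of_true this fun k _ hk => ?_
      rw [hgm, hgu k hk]
      exact hu _ (hmem u k hk)
    · obtain ⟨j, rfl⟩ : ∃ j', j = u.length + 1 + j' := ⟨j - u.length - 1, by omega⟩
      simp only [List.length_append, List.length_cons] at hj
      have hl := leftSize_node_add (decTree u) (decTree v) j
      have hle := leftSize_le (decTree v) j
      rw [hlen] at hl
      unfold Below at ihv ⊢
      rw [hl, hgv]
      by_cases hi : i ≤ u.length
      · refine iff_of_false (by omega) fun h => ?_
        have := h u.length hi (by omega)
        rw [hgm] at this
        exact absurd (hv _ (hmem v j (by omega))) (by omega)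
      · obtain ⟨i, rfl⟩ : ∃ i', i = u.length + 1 + i' := ⟨i - u.length - 1, by omega⟩
        have := ihv (i := i) (j := j) (by omega) (by omega)
        rw [show u.length + 1 + j ≤ u.length + 1 + i + leftSize (decTree v) j ↔
          j ≤ i + leftSize (decTree v) j by omega, this]
        constructor
        · intro h k hk hk'
          obtain ⟨k, rfl⟩ : ∃ k', k = u.length + 1 + k' := ⟨k - u.length - 1, by omega⟩
          rw [hgv]
          exact h k (by omega) (by omega)
        · intro h k hk hk'
          have := h (u.length + 1 + k) (by omega) (by omega)
          rwa [hgv] at this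

theorem val_graftPos_left (p q : ℕ) (a : Fin p) : (graftPos p q (.inl (.inl a)) : ℕ) = a := by
  simp [graftPos]

theorem val_graftPos_root (p q : ℕ) (a : Fin 1) : (graftPos p q (.inl (.inr a)) : ℕ) = p := by
  simp [graftPos]

theorem val_graftPos_right (p q : ℕ) (a : Fin q) :
    (graftPos p q (.inr a) : ℕ) = p + 1 + a := by
  simp [graftPos]

section graft

variable {p q : ℕ} (σ : Equiv.Perm (Fin p)) (τ : Equiv.Perm (Fin q))

theorem val_graft_left (a : Fin p) :
    (graft σ τ (graftPos p q (.inl (.inl a))) : ℕ) = q + σ a := by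
  simp [graft, graftVal]

theorem val_graft_root (a : Fin 1) :
    (graft σ τ (graftPos p q (.inl (.inr a))) : ℕ) = q + p := by
  simp [graft, graftVal]

theorem val_graft_right (a : Fin q) : (graft σ τ (graftPos p q (.inr a)) : ℕ) = τ a := by
  simp [graft, graftVal]

theorem graft_lt_iff {l r : BinaryTree Unit} (hl : l.numNodes = p)
    (hσ : ∀ i j, i < j → (σ i < σ j ↔ Below l i j))
    (hτ : ∀ i j, i < j → (τ i < τ j ↔ Below r i j)) (i j : Fin (p + q + 1)) (hij : i < j) :
    graft σ τ i < graft σ τ j ↔ Below (node () l r) i j := by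
  obtain ⟨x, rfl⟩ := (graftPos p q).surjective i
  obtain ⟨y, rfl⟩ := (graftPos p q).surjective j
  have hroot := leftSize_node_root l r
  rw [hl] at hroot
  rw [Fin.lt_def] at hij ⊢
  rcases y with (y | y) | y
  · have hy := leftSize_node_of_lt (r := r) (y.2.trans_eq hl.symm)
    rcases x with (x | x) | x <;>
      simp only [val_graftPos_left, val_graftPos_root, val_graftPos_right, val_graft_left,
        val_graft_root, val_graft_right] at hij ⊢
    · rw [Nat.add_lt_add_iff_left, ← Fin.lt_def, hσ x y hij, Below, Below, hy]
    · omega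
    · omega
  · rcases x with (x | x) | x <;>
      simp only [val_graftPos_left, val_graftPos_root, val_graftPos_right, val_graft_left,
        val_graft_root, val_graft_right, Below, hroot] at hij ⊢ <;> omega
  · have hy := leftSize_node_add l r y
    have hle := leftSize_le r y
    rw [hl] at hy
    rcases x with (x | x) | x <;>
      simp only [val_graftPos_left, val_graftPos_root, val_graftPos_right, val_graft_left,
        val_graft_root, val_graft_right, Below, hy] at hij ⊢
    · omega
    · omega
    · rw [← Fin.lt_def, hτ x y (Fin.lt_def.mpr (by omega)), Below]
      omega

end graft

/-- The pairs `i < j` that are not inversions of `γ(t)` are those in the relation `Below`. -/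
theorem gammaTree_lt_iff (t : BinaryTree Unit) (i j : Fin t.numNodes) (hij : i < j) :
    gammaTree t i < gammaTree t j ↔ Below t i j := by
  induction t with
  | nil => exact i.elim0
  | node _ l r ihl ihr => exact graft_lt_iff _ _ rfl ihl ihr i j hij

theorem gamma_lt_iff {n : ℕ} (t : Y n) (i j : Fin n) (hij : i < j) :
    gamma t i < gamma t j ↔ Below t.tree i j := by
  obtain ⟨t, rfl⟩ := t
  exact gammaTree_lt_iff t i j hij

/-- The trees above the decreasing tree of `σ` are those whose relation `Below` involves no
inversion of `σ`. -/
theorem lam_le_iff {n : ℕ} (σ : Equiv.Perm (Fin n)) (r : Y n) :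
    lam σ ≤ r ↔ ∀ i j : Fin n, i < j → Below r.tree i j → σ i < σ j := by
  have hget : ∀ i : Fin n, (List.ofFn fun i => (σ i : ℕ)).getD i 0 = σ i := fun i => by simp
  rw [le_iff_below]
  constructor
  · intro h i j hij hb
    have := (below_decTree _ hij (by simp)).mp (h i j hij j.2 hb) i le_rfl hij
    rwa [hget, hget] at this
  · intro h i j hij hj hb
    refine (below_decTree _ hij (by simpa using hj)).mpr fun k hik hkj => ?_
    rw [hget ⟨k, hkj.trans hj⟩, hget ⟨j, hj⟩]
    exact h ⟨k, hkj.trans hj⟩ ⟨j, hj⟩ hkj (hb.mono hik)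

/-! ### The preimage of a lower interval -/

/-- Shuffles are increasing on the first `p` and on the last `q` positions. -/
theorem shuffle_strictMono {p q : ℕ} {ζ : Equiv.Perm (Fin (p + q))} (hζ : ζ ∈ shuffles p q) :
    StrictMono (fun a => ζ (Fin.castAdd q a)) ∧ StrictMono (fun b => ζ (Fin.natAdd p b)) := by
  have key : ∀ i j : Fin (p + q), (i : ℕ) + 1 = j → (j : ℕ) ≠ p → ζ i < ζ j := by
    intro i j hij hj
    refine lt_of_le_of_ne (not_lt.mp fun hlt => hj (hζ ⟨i, j, hij, rfl, hlt⟩)) fun he => ?_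
    rw [ζ.injective he] at hij
    omega
  constructor
  · cases p with
    | zero => exact fun a => a.elim0
    | succ p =>
      refine Fin.strictMono_iff_lt_succ.mpr fun a => key _ _ (by simp) ?_
      have := a.2
      simp
      omega
  · cases q with
    | zero => exact fun a => a.elim0
    | succ q =>
      refine Fin.strictMono_iff_lt_succ.mpr fun a => key _ _ (by simp; omega) ?_
      simp

theorem slash_castAdd {p q : ℕ} (σ : Equiv.Perm (Fin p)) (τ : Equiv.Perm (Fin q)) (a : Fin p) :
    slash σ τ (Fin.castAdd q a) = Fin.castAdd q (σ a) := by
  simp [slash]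

theorem slash_natAdd {p q : ℕ} (σ : Equiv.Perm (Fin p)) (τ : Equiv.Perm (Fin q)) (b : Fin q) :
    slash σ τ (Fin.natAdd p b) = Fin.natAdd p (τ b) := by
  simp [slash]

/-- The decreasing tree of the letters of `γ(r)` at the positions `f 0, f 1, …`. For strictly
increasing `f`, its relation `Below` is the one of `r`, pulled back along `f`. -/
def restrict {m n : ℕ} (r : Y n) (f : Fin m → Fin n) : Y m :=
  ⟨decTree (List.ofFn fun a => (gamma r (f a) : ℕ)), by rw [numNodes_decTree, List.length_ofFn]⟩

/-- As `γ(r)` has no inversion at positions `i < j` exactly if `Below r i j`, and `Below` is upward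
closed in its first argument, `Below` for the tree of a subword of `γ(r)` only requires comparing
the two letters at the ends. -/
theorem le_restrict_iff {m n : ℕ} (r : Y n) {f : Fin m → Fin n} (hf : StrictMono f) (s : Y m) :
    s ≤ restrict r f ↔
      ∀ a b : Fin m, a < b → Below r.tree (f a) (f b) → Below s.tree a b := by
  have hget : ∀ a : Fin m, (List.ofFn fun a => (gamma r (f a) : ℕ)).getD a 0 = gamma r (f a) :=
    fun a => by simp
  have hiff : ∀ a b : Fin m, a < b →
      (Below (restrict r f).tree a b ↔ Below r.tree (f a) (f b)) := by
    intro a b hab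
    rw [restrict, below_decTree _ hab (by simp)]
    constructor
    · intro h
      have := h a le_rfl hab
      rwa [hget, hget, ← Fin.lt_def, gamma_lt_iff _ _ _ (hf hab)] at this
    · intro h k hak hkb
      have hk : k < m := hkb.trans b.2
      rw [hget ⟨k, hk⟩, hget, ← Fin.lt_def, gamma_lt_iff _ _ _ (hf (show ⟨k, hk⟩ < b from hkb))]
      exact h.mono (hf.monotone (show a ≤ ⟨k, hk⟩ from hak))
  rw [le_iff_below]
  constructor
  · intro h a b hab hb
    exact h a b hab b.2 ((hiff a b hab).mpr hb)
  · intro h i j hij hj hb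
    exact h ⟨i, hij.trans hj⟩ ⟨j, hj⟩ hij ((hiff ⟨i, hij.trans hj⟩ ⟨j, hj⟩ hij).mp hb)

/-- For a shuffle `ζ`, the condition `f_ζ(s, t) ≤ r` splits into a condition on `ζ` and `r` and one
upper bound for each of `s` and `t`. The bounds restrict the relation `Below` of `r` to the
positions of the two blocks. -/
theorem fMap_le_iff {p q : ℕ} {ζ : Equiv.Perm (Fin (p + q))} (hζ : ζ ∈ shuffles p q) (r : Y (p + q))
    (x : Y p × Y q) :
    fMap ζ x ≤ r ↔
      (∀ (a : Fin p) (b : Fin q), ζ (Fin.natAdd p b) < ζ (Fin.castAdd q a) →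
        ¬ Below r.tree (ζ (Fin.natAdd p b)) (ζ (Fin.castAdd q a))) ∧
      x ≤ (restrict r fun a => ζ (Fin.castAdd q a), restrict r fun b => ζ (Fin.natAdd p b)) := by
  obtain ⟨h₁, h₂⟩ := shuffle_strictMono hζ
  rw [Prod.le_def, le_restrict_iff r h₁, le_restrict_iff r h₂, fMap, lam_le_iff]
  have hw : ∀ a, (slash (gamma x.1) (gamma x.2) * ζ⁻¹) (ζ a) = slash (gamma x.1) (gamma x.2) a :=
    fun a => by simp
  constructor
  · intro h
    refine ⟨fun a b hlt hb => ?_, fun a b hab hb => ?_, fun a b hab hb => ?_⟩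
    · have := h _ _ hlt hb
      rw [hw, hw, slash_castAdd, slash_natAdd, Fin.lt_def, Fin.val_castAdd, Fin.val_natAdd] at this
      omega
    · have := h _ _ (h₁ hab) hb
      rwa [hw, hw, slash_castAdd, slash_castAdd, Fin.lt_def, Fin.val_castAdd, Fin.val_castAdd,
        ← Fin.lt_def, gamma_lt_iff _ _ _ hab]
        at this
    · have := h _ _ (h₂ hab) hb
      rwa [hw, hw, slash_natAdd, slash_natAdd, Fin.natAdd_lt_natAdd_iff, gamma_lt_iff _ _ _ hab]
        at this
  · rintro ⟨hc, hs, ht⟩ i j hij hb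
    obtain ⟨i, rfl⟩ := ζ.surjective i
    obtain ⟨j, rfl⟩ := ζ.surjective j
    rw [hw, hw]
    induction i using Fin.addCases with
    | left a =>
      induction j using Fin.addCases with
      | left b =>
        have hab : a < b := h₁.lt_iff_lt.mp hij
        rw [slash_castAdd, slash_castAdd, Fin.lt_def, Fin.val_castAdd, Fin.val_castAdd,
          ← Fin.lt_def, gamma_lt_iff _ _ _ hab]
        exact hs a b hab hb
      | right b =>
        rw [slash_castAdd, slash_natAdd, Fin.lt_def, Fin.val_castAdd, Fin.val_natAdd]
        omega
    | right a =>
      induction j using Fin.addCases with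
      | left b => exact absurd hb (hc b a hij)
      | right b =>
        have hab : a < b := h₂.lt_iff_lt.mp hij
        rw [slash_natAdd, slash_natAdd, Fin.natAdd_lt_natAdd_iff, gamma_lt_iff _ _ _ hab]
        exact ht a b hab hb

theorem lam_gamma {n : ℕ} (s : Y n) : lam (gamma s) = s := by
  refine eq_of_forall_ge_iff fun r => ?_
  rw [lam_le_iff, le_iff_below]
  constructor
  · intro h i j hij hj hb
    have := h ⟨i, hij.trans hj⟩ ⟨j, hj⟩ hij hb
    rwa [gamma_lt_iff _ _ _ hij] at this
  · intro h i j hij hb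
    rw [gamma_lt_iff _ _ _ hij]
    exact h i j hij j.2 hb

theorem decTree_gamma {n : ℕ} (s : Y n) : decTree (List.ofFn fun i => (gamma s i : ℕ)) = s.tree :=
  congrArg Y.tree (lam_gamma s)

/-! ### Dividing and grafting at the level of words -/

/-- Dividing the decreasing tree of a word at a leaf corresponds to cutting the word. -/
theorem splits_decTree (u : List ℕ) :
    splits (decTree u) =
      (List.range (u.length + 1)).map fun c => (decTree (u.take c), decTree (u.drop c)) := by
  induction u using decTree_induction with
  | nil => simp [decTree_nil, splits]
  | split u m v hu hv ihu ihv =>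
    have hr : List.range ((u ++ m :: v).length + 1) = List.range (u.length + 1) ++
        (List.range (v.length + 1)).map (u.length + 1 + ·) := by
      rw [← List.range_add, List.length_append, List.length_cons]
      congr 1
      omega
    rw [decTree_append_cons hu hv, splits, ihu, ihv, hr, List.map_append, List.map_map,
      List.map_map, List.map_map]
    congr 1
    · refine List.map_congr_left fun c hc => ?_
      have hc : c ≤ u.length := by simpa [Nat.lt_succ_iff] using hc
      rw [List.take_append_of_le_length hc, List.drop_append_of_le_length hc,
        decTree_append_cons (fun x hx => hu x (List.mem_of_mem_drop hx)) hv]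
      rfl
    · refine List.map_congr_left fun c _ => ?_
      have e₁ : (u ++ m :: v).take (u.length + 1 + c) = u ++ m :: v.take c := by
        rw [add_assoc, List.take_length_add_append, add_comm 1 c, List.take_succ_cons]
      have e₂ : (u ++ m :: v).drop (u.length + 1 + c) = v.drop c := by
        rw [add_assoc, List.drop_length_add_append, add_comm 1 c, List.drop_succ_cons]
      rw [Function.comp_apply, Function.comp_apply, e₁, e₂,
        decTree_append_cons hu fun x hx => hv x (List.mem_of_mem_take hx)]

/-- The divisions of a word into `q + 1` consecutive, possibly empty pieces. -/
def wordDivisions : ℕ → List ℕ → List (List (List ℕ))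
  | 0, u => [[u]]
  | q + 1, u =>
      (List.range (u.length + 1)).flatMap fun c =>
        (wordDivisions q (u.drop c)).map (u.take c :: ·)

theorem divisions_decTree (q : ℕ) (u : List ℕ) :
    divisions q (decTree u) = (wordDivisions q u).map (List.map decTree) := by
  induction q generalizing u with
  | zero => rfl
  | succ q ih =>
    rw [divisions, wordDivisions, splits_decTree, List.flatMap_map, List.map_flatMap]
    refine List.flatMap_congr fun c _ => ?_
    rw [ih, List.map_map, List.map_map]
    rfl

theorem mem_of_mem_wordDivisions {q : ℕ} {u : List ℕ} {us : List (List ℕ)}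
    (h : us ∈ wordDivisions q u) : ∀ y ∈ us, ∀ x ∈ y, x ∈ u := by
  induction q generalizing u us with
  | zero =>
    rw [wordDivisions, List.mem_singleton] at h
    simp [h]
  | succ q ih =>
    simp only [wordDivisions, List.mem_flatMap, List.mem_map] at h
    obtain ⟨c, _, vs, hvs, rfl⟩ := h
    intro y hy x hx
    rcases List.mem_cons.mp hy with rfl | hy
    · exact List.mem_of_mem_take hx
    · exact List.mem_of_mem_drop (ih hvs y hy x hx)

/-- The word `u₀ v₁ u₁ v₂ … v_q u_q` for a word `v = v₁ … v_q` and words `u₀, …, u_q`. -/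
def interleave : List ℕ → List (List ℕ) → List ℕ
  | [], us => us.headD []
  | x :: v, us => us.headD [] ++ x :: interleave v us.tail

theorem interleave_append_cons (a b : List ℕ) (m : ℕ) (us : List (List ℕ)) :
    interleave (a ++ m :: b) us =
      interleave a (us.take (a.length + 1)) ++ m :: interleave b (us.drop (a.length + 1)) := by
  induction a generalizing us with
  | nil => cases us <;> simp [interleave]
  | cons x a ih => cases us <;> simp [interleave, ih]

theorem mem_interleave {v : List ℕ} {us : List (List ℕ)} {x : ℕ} (h : x ∈ interleave v us) :
    x ∈ v ∨ ∃ u ∈ us, x ∈ u := by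
  induction v generalizing us with
  | nil => cases us <;> simp_all [interleave]
  | cons y v ih =>
    cases us with
    | nil =>
      rw [interleave, List.headD_nil, List.nil_append, List.mem_cons] at h
      rcases h with h | h
      · simp [h]
      · rcases ih h with h | h
        · simp [h]
        · simp at h
    | cons u us =>
      rw [interleave, List.headD_cons, List.mem_append, List.mem_cons] at h
      rcases h with h | h | h
      · exact .inr ⟨u, by simp, h⟩
      · simp [h]
      · rcases ih h with h | ⟨u', hu', h⟩
        · simp [h]
        · exact .inr ⟨u', List.mem_cons_of_mem _ hu', h⟩

/-- Interleaving with words of smaller letters corresponds to attaching their trees. -/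
theorem attach_decTree (v : List ℕ) (us : List (List ℕ))
    (h : ∀ u ∈ us, ∀ x ∈ u, ∀ y ∈ v, x < y) :
    attach (decTree v) (us.map decTree) = decTree (interleave v us) := by
  induction v using decTree_induction generalizing us with
  | nil => cases us <;> simp [decTree_nil, attach, interleave]
  | split a m b ha hb iha ihb =>
    have hn : (decTree a).numLeaves = a.length + 1 := by
      rw [BinaryTree.numLeaves_eq_numNodes_succ, numNodes_decTree]
    have h₁ : ∀ u ∈ us.take (a.length + 1), ∀ x ∈ u, ∀ y ∈ a, x < y :=
      fun u hu x hx y hy => h u (List.mem_of_mem_take hu) x hx y (by simp [hy])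
    have h₂ : ∀ u ∈ us.drop (a.length + 1), ∀ x ∈ u, ∀ y ∈ b, x < y :=
      fun u hu x hx y hy => h u (List.mem_of_mem_drop hu) x hx y (by simp [hy])
    rw [decTree_append_cons ha hb, attach, hn, ← List.map_take, ← List.map_drop, iha _ h₁,
      ihb _ h₂, interleave_append_cons, decTree_append_cons]
    · intro x hx
      rcases mem_interleave hx with hx | ⟨u, hu, hx⟩
      · exact ha x hx
      · exact h u (List.mem_of_mem_take hu) x hx m (by simp)
    · intro x hx
      rcases mem_interleave hx with hx | ⟨u, hu, hx⟩
      · exact hb x hx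
      · exact (h u (List.mem_of_mem_drop hu) x hx m (by simp)).le

/-- The list of all words obtained by shuffling `u` and `v`. -/
def wordShuffles (u v : List ℕ) : List (List ℕ) := (wordDivisions v.length u).map (interleave v)

theorem wordShuffles_cons (u v : List ℕ) (x : ℕ) :
    wordShuffles u (x :: v) =
      (List.range (u.length + 1)).flatMap fun c =>
        (wordShuffles (u.drop c) v).map (u.take c ++ x :: ·) := by
  rw [wordShuffles, List.length_cons, wordDivisions, List.map_flatMap]
  refine List.flatMap_congr fun c _ => ?_
  rw [wordShuffles, List.map_map, List.map_map]
  rfl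

theorem fundamentalMul_decTree (u v : List ℕ) (h : ∀ x ∈ u, ∀ y ∈ v, x < y) :
    fundamentalMul (decTree u) (decTree v) =
      ((wordShuffles u v).map fun w => fundamental (decTree w)).sum := by
  rw [fundamentalMul, numNodes_decTree, divisions_decTree, wordShuffles, List.map_map, List.map_map]
  congr 1
  refine List.map_congr_left fun us hus => ?_
  rw [Function.comp_apply, Function.comp_apply, attach_decTree]
  exact fun y hy x hx => h x (mem_of_mem_wordDivisions hus y hy x hx)

/-- If the letters of `u` are below `p` and those of `v` are not, the shuffles of `u` and `v` are
the words with these two subwords. -/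
theorem mem_wordShuffles {p : ℕ} {u v w : List ℕ} (hu : ∀ x ∈ u, x < p) (hv : ∀ x ∈ v, ¬ x < p) :
    w ∈ wordShuffles u v ↔ w.filter (· < p) = u ∧ w.filter (fun x => !decide (x < p)) = v := by
  induction v generalizing u w with
  | nil =>
    simp only [wordShuffles, List.length_nil, wordDivisions, List.map_cons, List.map_nil,
      List.mem_singleton, interleave, List.headD_cons]
    constructor
    · rintro rfl
      exact ⟨List.filter_eq_self.mpr (by simpa using hu),
        List.filter_eq_nil_iff.mpr (by simpa using hu)⟩
    · rintro ⟨h₁, h₂⟩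
      rw [← h₁, eq_comm, List.filter_eq_self]
      simpa using h₂
  | cons x v ih =>
    have hx : ¬ x < p := hv x (by simp)
    simp only [wordShuffles_cons, List.mem_flatMap, List.mem_map, List.mem_range]
    constructor
    · rintro ⟨c, _, w', hw', rfl⟩
      rw [ih (fun y hy => hu y (List.mem_of_mem_drop hy)) fun y hy => hv y (by simp [hy])] at hw'
      have ht : ∀ y ∈ u.take c, y < p := fun y hy => hu y (List.mem_of_mem_take hy)
      rw [List.filter_append, List.filter_append, List.filter_cons_of_neg (by simpa using hx),
        List.filter_cons_of_pos (by simpa using hx), hw'.1, hw'.2,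
        List.filter_eq_self.mpr (by simpa using ht), List.filter_eq_nil_iff.mpr (by simpa using ht)]
      simp
    · rintro ⟨h₁, h₂⟩
      obtain ⟨l₁, l₂, rfl, hl₁, _, hl₂⟩ := List.filter_eq_cons_iff.mp h₂
      have hl₁' : ∀ y ∈ l₁, y < p := by simpa using hl₁
      rw [List.filter_append, List.filter_cons_of_neg (by simpa using hx),
        List.filter_eq_self.mpr (by simpa using hl₁')] at h₁
      subst h₁
      refine ⟨l₁.length, by simp, l₂, ?_, by simp⟩
      rw [List.drop_left, ih (by simp) fun y hy => hv y (by simp [hy])]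
      exact ⟨rfl, hl₂⟩

theorem nodup_wordShuffles {u v : List ℕ} (h : ∀ x ∈ u, x ∉ v) : (wordShuffles u v).Nodup := by
  induction v generalizing u with
  | nil => simp [wordShuffles, wordDivisions]
  | cons x v ih =>
    rw [wordShuffles_cons, List.nodup_flatMap]
    constructor
    · intro c _
      refine (ih fun y hy hyv => h y (List.mem_of_mem_drop hy) (by simp [hyv])).map
        fun w w' he => ?_
      simpa using he
    · have hidx : ∀ c ≤ u.length, ∀ w, (u.take c ++ x :: w).idxOf x = c := by
        intro c hc w
        rw [List.idxOf_append_of_notMem fun hx => h x (List.mem_of_mem_take hx) (by simp)]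
        simpa using hc
      refine List.Pairwise.imp_of_mem (fun {c c'} hc hc' hne => ?_)
        (List.nodup_range (n := u.length + 1))
      rw [Function.onFun, List.disjoint_left]
      intro w hw hw'
      obtain ⟨_, _, rfl⟩ := List.mem_map.mp hw
      obtain ⟨_, _, he⟩ := List.mem_map.mp hw'
      have := congrArg (List.idxOf x) he
      rw [List.mem_range, Nat.lt_succ_iff] at hc hc'
      rw [hidx _ hc, hidx _ hc'] at this
      exact hne this.symm

/-! ### Shuffles of words and shuffle permutations -/

theorem ofFn_comp_sublist {α : Type*} {m n : ℕ} (w : Fin n → α) {f : Fin m → Fin n}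
    (hf : StrictMono f) : (List.ofFn (w ∘ f)).Sublist (List.ofFn w) := by
  have hsub : (List.ofFn f).Sublist (List.ofFn id) :=
    List.sublist_of_subperm_of_pairwise (r := (· < ·))
      ((List.nodup_ofFn.mpr hf.injective).subperm fun x _ => by simp)
      (List.pairwise_ofFn.mpr fun _ _ h => hf h) (List.pairwise_ofFn.mpr fun _ _ h => h)
  have := hsub.map w
  rwa [List.map_ofFn, List.map_ofFn] at this

section shuffle

variable {p q : ℕ} (σ : Equiv.Perm (Fin p)) (τ : Equiv.Perm (Fin q))

/-- The one-line notation of a permutation, with values starting at `0`. -/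
def word {n : ℕ} (π : Equiv.Perm (Fin n)) : List ℕ := List.ofFn fun i => (π i : ℕ)

theorem nodup_word {n : ℕ} (π : Equiv.Perm (Fin n)) : (word π).Nodup :=
  List.nodup_ofFn.mpr fun _ _ h => π.injective (Fin.ext h)

theorem lt_of_mem_word {n : ℕ} {π : Equiv.Perm (Fin n)} {x : ℕ} (h : x ∈ word π) : x < n := by
  obtain ⟨i, rfl⟩ := List.mem_ofFn.mp h
  exact (π i).2

theorem word_injective {n : ℕ} : Function.Injective (word : Equiv.Perm (Fin n) → List ℕ) :=
  fun _ _ h => Equiv.ext fun i => Fin.ext (congrFun (List.ofFn_injective h) i)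

theorem exists_word_eq {n : ℕ} {w : List ℕ} (hw : w.Nodup) (hlen : w.length = n)
    (hlt : ∀ x ∈ w, x < n) : ∃ π : Equiv.Perm (Fin n), word π = w := by
  subst hlen
  have hinj : Function.Injective fun i : Fin w.length =>
      (⟨w[i], hlt _ (List.getElem_mem _)⟩ : Fin w.length) := by
    intro i j hij
    exact Fin.ext ((hw.getElem_inj_iff).mp (congrArg Fin.val hij))
  refine ⟨Equiv.ofBijective _ (Finite.injective_iff_bijective.mp hinj), ?_⟩
  simp [word]

/-- The words of `(σ / τ) · ζ⁻¹`, for the shuffles `ζ`, are shuffles of the words of `σ` and of `τ`,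
the latter being shifted by `p`. -/
theorem mem_wordShuffles_word (ζ : Equiv.Perm (Fin (p + q))) (hζ : ζ ∈ shuffles p q) :
    word (slash σ τ * ζ⁻¹) ∈ wordShuffles (word σ) ((word τ).map (p + ·)) := by
  obtain ⟨h₁, h₂⟩ := shuffle_strictMono hζ
  have s₁ : (word σ).Sublist (word (slash σ τ * ζ⁻¹)) := by
    have := ofFn_comp_sublist (fun i => ((slash σ τ * ζ⁻¹) i : ℕ)) h₁
    simpa [word, Function.comp_def, slash_castAdd] using this
  have s₂ : ((word τ).map (p + ·)).Sublist (word (slash σ τ * ζ⁻¹)) := by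
    have := ofFn_comp_sublist (fun i => ((slash σ τ * ζ⁻¹) i : ℕ)) h₂
    simpa [word, Function.comp_def, slash_natAdd] using this
  have hu : ∀ x ∈ word σ, x < p := fun x hx => lt_of_mem_word hx
  have hv : ∀ x ∈ (word τ).map (p + ·), ¬ x < p := by simp
  have hnd := nodup_word (slash σ τ * ζ⁻¹)
  rw [mem_wordShuffles hu hv]
  constructor
  -- A sublist that is at least as long as the whole list is the whole list.
  · have := s₁.filter (· < p)
    rw [List.filter_eq_self.mpr (by simpa using hu)] at this
    refine (this.eq_of_length_le ?_).symm
    have hsub : (word (slash σ τ * ζ⁻¹)).filter (· < p) ⊆ List.range p := fun x hx => by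
      simpa using (List.mem_filter.mp hx).2
    simpa [word] using ((hnd.filter _).subperm hsub).length_le
  · have := s₂.filter (fun x => !decide (x < p))
    rw [List.filter_eq_self.mpr (by simp)] at this
    refine (this.eq_of_length_le ?_).symm
    have hsub : (word (slash σ τ * ζ⁻¹)).filter (fun x => !decide (x < p)) ⊆ List.range' p q :=
      fun x hx => by
        have h := List.mem_filter.mp hx
        simpa using ⟨by simpa using h.2, lt_of_mem_word h.1⟩
    simpa [word] using ((hnd.filter _).subperm hsub).length_le

/-- Every shuffle of the two words arises from a shuffle permutation. -/
theorem exists_shuffle_of_mem_wordShuffles {w : List ℕ}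
    (hw : w ∈ wordShuffles (word σ) ((word τ).map (p + ·))) :
    ∃ ζ ∈ shuffles p q, word (slash σ τ * ζ⁻¹) = w := by
  have hu : ∀ x ∈ word σ, x < p := fun x hx => lt_of_mem_word hx
  have hv : ∀ x ∈ (word τ).map (p + ·), ¬ x < p := by simp
  obtain ⟨h₁, h₂⟩ := (mem_wordShuffles hu hv).mp hw
  have hperm := List.filter_append_perm (· < p) w
  rw [h₁, h₂] at hperm
  have hnd : w.Nodup := hperm.nodup_iff.mp <| by
    refine (nodup_word σ).append ((nodup_word τ).map fun _ _ h => by simpa using h) ?_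
    rw [List.disjoint_left]
    exact fun x hx hx' => hv x hx' (hu x hx)
  obtain ⟨π, rfl⟩ := exists_word_eq hnd (n := p + q) (by rw [← hperm.length_eq]; simp [word])
    fun x hx => by
      rcases List.mem_append.mp (hperm.mem_iff.mpr hx) with h | h
      · exact (hu x h).trans_le (by omega)
      · obtain ⟨y, hy, rfl⟩ := List.mem_map.mp h
        have := lt_of_mem_word hy
        omega
  refine ⟨π⁻¹ * slash σ τ, ?_, by simp⟩
  -- The positions of letters increase along the word `π`, hence along its two subwords.
  have hpw : (word π).Pairwise fun x y =>
      ∃ i j : Fin (p + q), i < j ∧ (π i : ℕ) = x ∧ (π j : ℕ) = y :=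
    List.pairwise_ofFn.mpr fun i j hij => ⟨i, j, hij, rfl, rfl⟩
  have hpos : ∀ i c, (π i : ℕ) = slash σ τ c → i = (π⁻¹ * slash σ τ) c := fun i c h => by
    rw [Equiv.Perm.mul_apply, Equiv.Perm.eq_inv_iff_eq]
    exact Fin.ext h
  have key₁ : ∀ a b : Fin p, a < b →
      (π⁻¹ * slash σ τ) (Fin.castAdd q a) < (π⁻¹ * slash σ τ) (Fin.castAdd q b) := by
    have := hpw.filter (· < p)
    rw [h₁, word, List.pairwise_ofFn] at this
    intro a b hab
    obtain ⟨i, j, hij, hi, hj⟩ := this hab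
    rwa [← hpos i, ← hpos j]
    · simp [slash_castAdd, hj]
    · simp [slash_castAdd, hi]
  have key₂ : ∀ a b : Fin q, a < b →
      (π⁻¹ * slash σ τ) (Fin.natAdd p a) < (π⁻¹ * slash σ τ) (Fin.natAdd p b) := by
    have := hpw.filter (fun x => !decide (x < p))
    rw [h₂, word, List.map_ofFn, List.pairwise_ofFn] at this
    intro a b hab
    obtain ⟨i, j, hij, hi, hj⟩ := this hab
    rwa [← hpos i, ← hpos j]
    · simp [slash_natAdd, hj]
    · simp [slash_natAdd, hi]
  rintro k ⟨i, j, hik, hjk, hlt⟩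
  by_contra hne
  rw [Set.mem_singleton_iff] at hne
  refine hlt.not_gt ?_
  induction i using Fin.addCases with
  | left a =>
    induction j using Fin.addCases with
    | left b => exact key₁ a b (Fin.lt_def.mpr (by simp at hik hjk; omega))
    | right b => simp at hik hjk; omega
  | right a =>
    induction j using Fin.addCases with
    | left b => simp at hik hjk; omega
    | right b => exact key₂ a b (Fin.lt_def.mpr (by simp at hik hjk; omega))

end shuffle

open Classical in
/-- The product in the fundamental basis as a sum over shuffles. -/
theorem fundamental_mul_eq_sum {p q : ℕ} (s : Y p) (t : Y q) :
    fundamental s.tree * fundamental t.tree =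
      ∑ ζ : Equiv.Perm (Fin (p + q)) with ζ ∈ shuffles p q, fundamental (fMap ζ (s, t)).tree := by
  have ht : decTree ((word (gamma t)).map (p + ·)) = t.tree :=
    (decTree_map _ _ fun a _ b _ h => by omega).trans (decTree_gamma t)
  have hlt : ∀ x ∈ word (gamma s), ∀ y ∈ (word (gamma t)).map (p + ·), x < y := by
    intro x hx y hy
    obtain ⟨z, _, rfl⟩ := List.mem_map.mp hy
    exact (lt_of_mem_word hx).trans_le (Nat.le_add_right _ _)
  have hnd := nodup_wordShuffles (u := word (gamma s)) (v := (word (gamma t)).map (p + ·))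
    fun x hx hx' => (hlt x hx x hx').false
  have hs : decTree (word (gamma s)) = s.tree := decTree_gamma s
  rw [fundamental_mul_fundamental, ← hs, ← ht, fundamentalMul_decTree _ _ hlt,
    ← List.sum_toFinset _ hnd]
  symm
  refine Finset.sum_nbij (fun ζ => word (slash (gamma s) (gamma t) * ζ⁻¹)) ?_ ?_ ?_ ?_
  · intro ζ hζ
    rw [List.mem_toFinset]
    exact mem_wordShuffles_word _ _ ζ (by simpa using hζ)
  · intro ζ _ ζ' _ h
    simpa using word_injective h
  · intro w hw
    obtain ⟨ζ, hζ, h⟩ := exists_shuffle_of_mem_wordShuffles (gamma s) (gamma t)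
      (w := w) (by simpa using hw)
    exact ⟨ζ, by simpa using hζ, h⟩
  · intro ζ _
    rfl

/-! ### Coefficients in the monomial basis -/

theorem fundamental_eq_sum_monomial {n : ℕ} (s : Y n) :
    fundamental s.tree = ∑ u : Y n with s ≤ u, monomial u := by
  have := LinearMap.congr_fun toMonomial_comp_upperSum (fundamental s.tree)
  rw [LinearMap.comp_apply, upperSum_fundamental, map_sum] at this
  simp only [toMonomial_fundamental] at this
  exact this.symm

theorem repr_fundamental {n : ℕ} (s : Y n) (r : BinaryTree Unit) :
    monomialBasis.repr (fundamental s.tree) r =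
      ∑ u : Y n with s ≤ u, if u.tree = r then 1 else 0 := by
  simp only [fundamental_eq_sum_monomial, map_sum, ← monomialBasis_apply, Module.Basis.repr_self,
    Finsupp.finsetSum_apply, Finsupp.single_apply]

theorem repr_fundamental_tree {n : ℕ} (s r : Y n) :
    monomialBasis.repr (fundamental s.tree) r.tree = if s ≤ r then 1 else 0 := by
  rw [repr_fundamental]
  simp [← Y.ext_iff]

theorem repr_fundamental_of_ne {m n : ℕ} (h : m ≠ n) (s : Y m) (r : Y n) :
    monomialBasis.repr (fundamental s.tree) r.tree = 0 := by
  rw [repr_fundamental]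
  refine Finset.sum_eq_zero fun u _ => if_neg fun he => h ?_
  rw [← u.numNodes_eq, he, r.numNodes_eq]

theorem fundamental_mul_eq_sum_monomial_mul {p q : ℕ} (x : Y p × Y q) :
    fundamental x.1.tree * fundamental x.2.tree =
      ∑ y : Y p × Y q with x ≤ y, monomial y.1 * monomial y.2 := by
  change mulBilin _ _ = ∑ y : Y p × Y q with x ≤ y, mulBilin (monomial y.1) (monomial y.2)
  simp only [fundamental_eq_sum_monomial, map_sum, LinearMap.sum_apply]
  rw [Finset.sum_comm, ← Finset.sum_product', ← Finset.filter_product, Finset.univ_product_univ]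
  rfl

/-- Möbius inversion on a finite partially ordered set, in the form of a uniqueness statement. -/
theorem eq_of_sum_upper_eq {P : Type*} [PartialOrder P] [Fintype P] [DecidableLE P] {c d : P → ℚ}
    (h : ∀ x, ∑ y with x ≤ y, c y = ∑ y with x ≤ y, d y) (x : P) : c x = d x := by
  classical
  induction x using WellFoundedGT.induction with
  | ind x ih =>
    have hx : x ∈ Finset.univ.filter (x ≤ ·) := by simp
    have := h x
    rw [← Finset.add_sum_erase _ _ hx, ← Finset.add_sum_erase _ _ hx] at this
    rw [Finset.sum_congr rfl fun y hy => ih y ?_] at this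
    · exact add_right_cancel this
    · rw [Finset.mem_erase, Finset.mem_filter] at hy
      exact lt_of_le_of_ne hy.2.2 hy.1.symm

open Classical in
/-- A shuffle `ζ` with `f_ζ(x) ≤ r` is counted exactly once, at the greatest element of
`f_ζ⁻¹ [1, r]`. -/
theorem sum_isGreatest {p q : ℕ} {ζ : Equiv.Perm (Fin (p + q))} (hζ : ζ ∈ shuffles p q)
    (r : Y (p + q)) (x : Y p × Y q) :
    (∑ y : Y p × Y q with x ≤ y,
      if IsGreatest (fMap ζ ⁻¹' Set.Icc (comb (p + q)) r) y then (1 : ℚ) else 0) =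
      if fMap ζ x ≤ r then 1 else 0 := by
  have hmem : ∀ y, y ∈ fMap ζ ⁻¹' Set.Icc (comb (p + q)) r ↔ fMap ζ y ≤ r := fun y => by
    simp [comb_le]
  by_cases hc : ∀ (a : Fin p) (b : Fin q), ζ (Fin.natAdd p b) < ζ (Fin.castAdd q a) →
        ¬ Below r.tree (ζ (Fin.natAdd p b)) (ζ (Fin.castAdd q a))
  · obtain ⟨m, hm⟩ : ∃ m : Y p × Y q, ∀ y, fMap ζ y ≤ r ↔ y ≤ m :=
      ⟨_, fun y => (fMap_le_iff hζ r y).trans (and_iff_right hc)⟩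
    have hset : fMap ζ ⁻¹' Set.Icc (comb (p + q)) r = Set.Iic m :=
      Set.ext fun y => (hmem y).trans (hm y)
    have hgr : ∀ y, IsGreatest (Set.Iic m) y ↔ m = y :=
      fun y => ⟨fun h => isGreatest_Iic.unique h, fun h => h ▸ isGreatest_Iic⟩
    simp only [hset, hgr, hm]
    simp
  · have hle : ∀ y, ¬ fMap ζ y ≤ r := fun y h => hc ((fMap_le_iff hζ r y).mp h).1
    rw [if_neg (hle x)]
    exact Finset.sum_eq_zero fun y _ => if_neg fun h => hle y ((hmem y).mp h.1)

open Classical in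
theorem sum_repr_monomial_mul {p q : ℕ} (r : BinaryTree Unit) (x : Y p × Y q) :
    ∑ y : Y p × Y q with x ≤ y, monomialBasis.repr (monomial y.1 * monomial y.2) r =
      ∑ ζ : Equiv.Perm (Fin (p + q)) with ζ ∈ shuffles p q,
        monomialBasis.repr (fundamental (fMap ζ x).tree) r := by
  have h := congrArg (monomialBasis.coord r)
    ((fundamental_mul_eq_sum_monomial_mul x).symm.trans (fundamental_mul_eq_sum x.1 x.2))
  rw [map_sum, map_sum] at h
  exact h

theorem repr_monomial_mul {p q : ℕ} (r : Y (p + q)) (x : Y p × Y q) :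
    monomialBasis.repr (monomial x.1 * monomial x.2) r.tree =
      ({ζ : Equiv.Perm (Fin (p + q)) | ζ ∈ shuffles p q ∧
        IsGreatest (fMap ζ ⁻¹' Set.Icc (comb (p + q)) r) x}.ncard : ℚ) := by
  classical
  refine eq_of_sum_upper_eq (P := Y p × Y q)
    (c := fun x : Y p × Y q => monomialBasis.repr (monomial x.1 * monomial x.2) r.tree)
    (d := fun x : Y p × Y q => ({ζ : Equiv.Perm (Fin (p + q)) | ζ ∈ shuffles p q ∧
        IsGreatest (fMap ζ ⁻¹' Set.Icc (comb (p + q)) r) x}.ncard : ℚ)) (fun x => ?_) x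
  have hcard : ∀ y, ({ζ : Equiv.Perm (Fin (p + q)) | ζ ∈ shuffles p q ∧
      IsGreatest (fMap ζ ⁻¹' Set.Icc (comb (p + q)) r) y}.ncard : ℚ) =
      ∑ ζ : Equiv.Perm (Fin (p + q)) with ζ ∈ shuffles p q,
        if IsGreatest (fMap ζ ⁻¹' Set.Icc (comb (p + q)) r) y then (1 : ℚ) else 0 := by
    intro y
    rw [Set.ncard_eq_toFinset_card', Finset.sum_boole, Finset.filter_filter, Set.toFinset_ofPred]
  simp only [hcard]
  rw [sum_repr_monomial_mul, Finset.sum_comm]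
  refine Finset.sum_congr rfl fun ζ hζ => ?_
  rw [repr_fundamental_tree, sum_isGreatest (Finset.mem_filter.mp hζ).2]

theorem repr_monomial_mul_of_ne {p q n : ℕ} (h : p + q ≠ n) (r : Y n) (x : Y p × Y q) :
    monomialBasis.repr (monomial x.1 * monomial x.2) r.tree = 0 := by
  classical
  refine eq_of_sum_upper_eq (P := Y p × Y q)
    (c := fun x : Y p × Y q => monomialBasis.repr (monomial x.1 * monomial x.2) r.tree)
    (d := fun _ => 0) (fun x => ?_) x
  rw [sum_repr_monomial_mul, Finset.sum_const_zero]
  exact Finset.sum_eq_zero fun ζ _ => repr_fundamental_of_ne h _ _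

end YSymmetric

theorem theorem4p1 (p q : ℕ) (s : YSymmetric.Y p) (t : YSymmetric.Y q) :
    (∀ r : YSymmetric.Y (p + q),
      YSymmetric.monomialBasis.repr (YSymmetric.monomial s * YSymmetric.monomial t) r.tree =
        ({ζ : Equiv.Perm (Fin (p + q)) | ζ ∈ YSymmetric.shuffles p q ∧
          IsGreatest (YSymmetric.fMap ζ ⁻¹' Set.Icc (YSymmetric.comb (p + q)) r)
            (s, t)}.ncard : ℚ)) ∧
    (∀ (n : ℕ) (r : YSymmetric.Y n),
      0 ≤ YSymmetric.monomialBasis.repr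
        (YSymmetric.monomial s * YSymmetric.monomial t) r.tree) := by
  refine ⟨fun r => YSymmetric.repr_monomial_mul r (s, t), fun n r => ?_⟩
  by_cases h : p + q = n
  · subst h
    exact (Nat.cast_nonneg _).trans_eq (YSymmetric.repr_monomial_mul r (s, t)).symm
  · exact (YSymmetric.repr_monomial_mul_of_ne h r (s, t)).ge
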